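/- Let $d,N,s\ge 0$ and $p\ge 0$ be integers and let $f^{[1]},\dots,f^{[N]}:\mathbb R^d\to\mathbb R^d$. A non-standard additive Runge--Kutta (NSARK) method with coefficient functions $a_{ij}^{[\nu]}(y,\Delta t)$, $b_j^{[\nu]}(y,\Delta t)\in\mathbb R$ ($i,j=1,\dots,s$, $\nu=1,\dots,N$; arbitrary functions of $y\in\mathbb R^d$ and of the step size $\Delta t$), applied to the autonomous system $y'=\sum_{\nu=1}^N f^{[\nu]}(y)$, is $$y^{(i)}=y^n+\Delta t\sum_{j=1}^s\sum_{\nu=1}^N a_{ij}^{[\nu]}(y^n,\Delta t)f^{[\nu]}(y^{(j)}),\quad i=1,\dots,s,\qquad y^{n+1}=y^n+\Delta t\sum_{j=1}^s\sum_{\nu=1}^N b_{j}^{[\nu]}(y^n,\Delta t)f^{[\nu]}(y^{(j)}).$$ Let $NT$ be the set of finite rooted trees with nodes colored in $\{1,\dots,N\}$ (children unordered). Write $\tau=[\tau_1,\dots,\tau_k]^{[\mu]}$ for the tree with root color $\mu$ and children $\tau_1,\dots,\tau_k$ ($k=0$ is the one-node tree), $|\tau|$ for the number of nodes, and $NT_p=\{\tau\in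 NT:|\tau|\le p\}$. If the children of $\tau$ are $m_1$ copies of $\theta_1$, …, $m_r$ copies of $\theta_r$ with pairwise different $\theta_j$, put $\sigma(\tau)=\prod_{j=1}^r m_j!\,\sigma(\theta_j)^{m_j}$; so $\sigma=1$ on one-node trees. The elementary differentials are $$\mathcal F([\tau_1,\dots,\tau_k]^{[\mu]})(y)=\sum_{i_1,\dots,i_k=1}^d\partial_{i_1\cdots i_k}f^{[\mu]}(y)\,\mathcal F_{i_1}(\tau_1)(y)\cdots\mathcal F_{i_k}(\tau_k)(y),$$ which is $f^{[\mu]}(y)$ for $k=0$. Define recursively, with $\delta$ the Kronecker delta and all coefficients evaluated at $(y,\Delta t)$, $$g_i^{[\nu]}([\tau_1,\dots,\tau_k]^{[\mu]},y,\Delta t)=\delta_{\nu\mu}\prod_{m=1}^k d_i(\tau_m,y,\Delta t),\qquad d_i(\tau,y,\Delta t)=\sum_{\nu=1}^N\sum_{j=1}^s a_{ij}^{[\nu]}\,g_j^{[\nu]}(\tau,y,\Delta t),$$ $$u(\tau,y,\Delta t)=\sum_{\nu=1}^N\sum_{i=1}^s b_i^{[\nu]}\,g_i^{[\nu]}(\tau,y,\Delta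 t),$$ where the empty product is $1$. **Theorem.** Fix $y^n\in\mathbb R^d$. Suppose that each $f^{[\nu]}$ is of class $C^{p+1}$ and Lipschitz continuous on $\mathbb R^d$, that $a_{ij}^{[\nu]}(y^n,\Delta t)=O(1)$ as $\Delta t\to0^+$ for all $i,j,\nu$, and that for all sufficiently small $\Delta t>0$ the stage equations have a solution. Then every family of solutions $y^{(1)},\dots,y^{(s)}$ of the stage equations (one solution for each sufficiently small $\Delta t>0$) satisfies, as $\Delta t\to0^+$, for all $i=1,\dots,s$ and $\nu=1,\dots,N$, $$y^{(i)}=y^n+\sum_{\tau\in NT_p}\frac{\Delta t^{|\tau|}}{\sigma(\tau)}d_i(\tau,y^n,\Delta t)\,\mathcal F(\tau)(y^n)+O(\Delta t^{p+1}),$$ $$\Delta t\,f^{[\nu]}(y^{(i)})=\sum_{\tau\in NT_p}\frac{\Delta t^{|\tau|}}{\sigma(\tau)}g_i^{[\nu]}(\tau,y^n,\Delta t)\,\mathcal F(\tau)(y^n)+O(\Delta t^{p+1}).$$ If moreover $b_j^{[\nu]}(y^n,\Delta t)=O(1)$ as $\Delta t\to0^+$ for all $j,\nu$, then also $$y^{n+1}=y^n+\sum_{\tau\in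 NT_p}\frac{\Delta t^{|\tau|}}{\sigma(\tau)}u(\tau,y^n,\Delta t)\,\mathcal F(\tau)(y^n)+O(\Delta t^{p+1}).$$ -/

import Mathlib

open Filter Topology Asymptotics
open scoped Nat

noncomputable section

/-- Finite rooted trees with nodes colored in `Fin N`, in which the children of every node are
listed in some order. -/
inductive OrderedTree (N : ℕ) : Type
  | node (ν : Fin N) (k : ℕ) (child : Fin k → OrderedTree N) : OrderedTree N

namespace OrderedTree

variable {N : ℕ}

/-- Two ordered trees are isomorphic as colored rooted trees: equal root colors, and the children
are pairwise isomorphic after a permutation. -/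
def Iso : OrderedTree N → OrderedTree N → Prop
  | node μ k c, node ν l c' => μ = ν ∧ ∃ e : Fin k ≃ Fin l, ∀ i, Iso (c i) (c' (e i))

theorem Iso.refl : ∀ t : OrderedTree N, Iso t t
  | node _ _ c => ⟨rfl, Equiv.refl _, fun i => Iso.refl (c i)⟩

theorem Iso.symm : ∀ {t t' : OrderedTree N}, Iso t t' → Iso t' t
  | node _ _ _, node _ _ c', ⟨h, e, H⟩ =>
    ⟨h.symm, e.symm, fun i => Iso.symm (by
      have := H (e.symm i)
      rwa [e.apply_symm_apply] at this)⟩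

theorem Iso.trans : ∀ {t t' t'' : OrderedTree N}, Iso t t' → Iso t' t'' → Iso t t''
  | node _ _ _, node _ _ _, node _ _ _, ⟨h, e, H⟩, ⟨h', e', H'⟩ =>
    ⟨h.trans h', e.trans e', fun i => Iso.trans (H i) (H' (e i))⟩

instance setoid (N : ℕ) : Setoid (OrderedTree N) where
  r := Iso
  iseqv := ⟨Iso.refl, Iso.symm, Iso.trans⟩

/-- The number of nodes. -/
def order : OrderedTree N → ℕ
  | node _ _ c => 1 + ∑ i, order (c i)

open Classical in
/-- The symmetry: if, up to isomorphism, the children are `τ₁` (`m₁` times), …, `τᵣ` (`mᵣ` times)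
with pairwise different `τⱼ`, the value is `∏ⱼ mⱼ! σ(τⱼ) ^ mⱼ`. -/
def symmetry : OrderedTree N → ℕ
  | node _ _ c =>
    (∏ C ∈ Finset.univ.image (fun i => (⟦c i⟧ : Quotient (setoid N))),
      (Finset.univ.filter (fun i => (⟦c i⟧ : Quotient (setoid N)) = C)).card !) *
    ∏ i, symmetry (c i)

/-- The elementary differential: `F([τ₁,…,τₖ]^[ν])(y)` is the `k`-th derivative of `f^[ν]` at `y`
evaluated at the vectors `F(τ₁)(y), …, F(τₖ)(y)`, that is
`∑ ∂_{i₁…iₖ} f^[ν](y) F_{i₁}(τ₁)(y) ⋯ F_{iₖ}(τₖ)(y)`. -/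
def elemDiff {d : ℕ} (f : Fin N → EuclideanSpace ℝ (Fin d) → EuclideanSpace ℝ (Fin d)) :
    OrderedTree N → EuclideanSpace ℝ (Fin d) → EuclideanSpace ℝ (Fin d)
  | node ν k c, y => iteratedFDeriv ℝ k (f ν) y (fun i => elemDiff f (c i) y)

/-- The coefficients `g_i^[ν]` for a tableau with entries `A ν i j`: on a tree with root color `μ`
and children `τ₁, …, τₖ` the value is `δ_{νμ} ∏ₘ d_i(τₘ)` with
`d_i(τ) = ∑_κ ∑_j A κ i j * g_j^[κ](τ)`. -/
def g {s : ℕ} (A : Fin N → Fin s → Fin s → ℝ) : OrderedTree N → Fin s → Fin N → ℝ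
  | node μ _ c, i, ν =>
    (if ν = μ then 1 else 0) * ∏ m, ∑ κ, ∑ j, A κ i j * g A (c m) j κ

theorem order_congr : ∀ {t t' : OrderedTree N}, Iso t t' → order t = order t'
  | node _ _ c, node _ _ c', ⟨_, e, H⟩ => by
    simp only [order]
    rw [Fintype.sum_equiv e (fun i => order (c i)) (fun i => order (c' i))
      (fun i => order_congr (H i))]

theorem symmetry_congr : ∀ {t t' : OrderedTree N}, Iso t t' → symmetry t = symmetry t'
  | node _ _ c, node _ _ c', ⟨_, e, H⟩ => by
    classical
    have hq : ∀ i, (⟦c i⟧ : Quotient (setoid N)) = ⟦c' (e i)⟧ := fun i => Quotient.sound (H i)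
    simp only [symmetry]
    rw [Fintype.prod_equiv e (fun i => symmetry (c i)) (fun i => symmetry (c' i))
      (fun i => symmetry_congr (H i))]
    congr 1
    have himg : Finset.univ.image (fun i => (⟦c i⟧ : Quotient (setoid N))) =
        Finset.univ.image (fun i => (⟦c' i⟧ : Quotient (setoid N))) := by
      ext C
      simp only [Finset.mem_image, Finset.mem_univ, true_and, hq]
      exact ⟨fun ⟨i, hi⟩ => ⟨e i, hi⟩, fun ⟨i, hi⟩ => ⟨e.symm i, by simpa using hi⟩⟩
    rw [himg]
    refine Finset.prod_congr rfl fun C _ => ?_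
    congr 1
    refine Finset.card_equiv e fun i => ?_
    simp [hq]

theorem g_congr {s : ℕ} (A : Fin N → Fin s → Fin s → ℝ) :
    ∀ {t t' : OrderedTree N}, Iso t t' → g A t = g A t'
  | node _ _ c, node _ _ c', ⟨h, e, H⟩ => by
    funext i ν
    simp only [g, h]
    congr 1
    refine Fintype.prod_equiv e _ _ fun m => ?_
    rw [g_congr A (H m)]

theorem finite_order_le (q : ℕ) : {t : OrderedTree N | order t ≤ q}.Finite := by
  induction q with
  | zero =>
    refine Set.Finite.subset Set.finite_empty ?_
    rintro ⟨ν, k, c⟩ h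
    simp [order] at h
  | succ q ih =>
    have hfin : (⋃ ν : Fin N, ⋃ k ∈ Set.Iic q,
        (fun c => node ν k c) '' (Set.pi Set.univ fun _ : Fin k => {t | order t ≤ q})).Finite :=
      Set.finite_iUnion fun ν => (Set.finite_Iic q).biUnion fun k _ =>
        (Set.Finite.pi fun _ => ih).image _
    refine hfin.subset ?_
    rintro ⟨ν, k, c⟩ h
    have hsum : ∑ i, order (c i) ≤ q := by
      have h' : 1 + ∑ i, order (c i) ≤ q + 1 := h
      omega
    have hpos : ∀ t : OrderedTree N, 1 ≤ order t := by
      rintro ⟨ν, k, c⟩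
      simp [order]
    have hk : k ≤ q := by
      have : ∑ _i : Fin k, 1 ≤ ∑ i, order (c i) := Finset.sum_le_sum fun i _ => hpos _
      simp at this
      omega
    simp only [Set.mem_iUnion]
    refine ⟨ν, k, hk, c, fun i _ => ?_, rfl⟩
    exact (Finset.single_le_sum (f := fun i => order (c i)) (fun _ _ => Nat.zero_le _)
      (Finset.mem_univ i)).trans hsum

end OrderedTree

/-- The set `NT` of colored rooted trees (`N`-trees): the order of the children is forgotten. -/
def ColoredTree (N : ℕ) : Type := Quotient (OrderedTree.setoid N)

namespace ColoredTree

variable {N : ℕ}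

/-- The order `|τ|`, the number of nodes. -/
def order (τ : ColoredTree N) : ℕ :=
  Quotient.lift OrderedTree.order (fun _ _ h => OrderedTree.order_congr h) τ

/-- The symmetry `σ(τ)`. -/
def symmetry (τ : ColoredTree N) : ℕ :=
  Quotient.lift OrderedTree.symmetry (fun _ _ h => OrderedTree.symmetry_congr h) τ

/-- The elementary differential `F(τ)`. Derivatives of smooth maps are symmetric multilinear maps,
so the ordering of the children chosen by `Quotient.out` is immaterial. -/
def elemDiff {d : ℕ} (f : Fin N → EuclideanSpace ℝ (Fin d) → EuclideanSpace ℝ (Fin d))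
    (τ : ColoredTree N) : EuclideanSpace ℝ (Fin d) → EuclideanSpace ℝ (Fin d) :=
  OrderedTree.elemDiff f (Quotient.out τ)

theorem finite_order_le (q : ℕ) : {τ : ColoredTree N | order τ ≤ q}.Finite := by
  refine ((OrderedTree.finite_order_le (N := N) q).image
    (fun t => (Quotient.mk _ t : ColoredTree N))).subset ?_
  rintro ⟨t⟩ h
  exact ⟨t, h, rfl⟩

/-- The set `NT_q` of colored rooted trees with at most `q` nodes. -/
def upTo (N q : ℕ) : Finset (ColoredTree N) := (finite_order_le (N := N) q).toFinset

end ColoredTree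

/-- The sum `∑_{τ ∈ NT_p} Δt^|τ| / σ(τ) * w(τ) F(τ)(y)`, so that `y + nbSum f p w y Δt` is the
NB-series with coefficients `w` truncated at order `p`. -/
def nbSum {d N : ℕ} (f : Fin N → EuclideanSpace ℝ (Fin d) → EuclideanSpace ℝ (Fin d)) (p : ℕ)
    (w : ColoredTree N → ℝ) (y : EuclideanSpace ℝ (Fin d)) (Δt : ℝ) : EuclideanSpace ℝ (Fin d) :=
  ∑ τ ∈ ColoredTree.upTo N p, (Δt ^ τ.order / (τ.symmetry : ℝ) * w τ) • τ.elemDiff f y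

/-- A non-standard additive Runge--Kutta method with `s` stages for right-hand sides split into `N`
addends on `ℝ^d`: the Butcher coefficients `a_{ij}^[ν](y, Δt)` and `b_j^[ν](y, Δt)` are arbitrary
functions of the current approximation and the step size. -/
structure NSARK (d N s : ℕ) where
  /-- the coefficients `a_{ij}^[ν](y, Δt)`, written `a ν i j y Δt` -/
  a : Fin N → Fin s → Fin s → EuclideanSpace ℝ (Fin d) → ℝ → ℝ
  /-- the coefficients `b_j^[ν](y, Δt)`, written `b ν j y Δt` -/
  b : Fin N → Fin s → EuclideanSpace ℝ (Fin d) → ℝ → ℝ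

namespace NSARK

variable {d N s : ℕ}

/-- `Y` solves the stage equations
`Y i = y + Δt ∑_j ∑_ν a_{ij}^[ν](y, Δt) f^[ν](Y j)`, `i = 1, …, s`. -/
def IsStageSolution (M : NSARK d N s)
    (f : Fin N → EuclideanSpace ℝ (Fin d) → EuclideanSpace ℝ (Fin d))
    (y : EuclideanSpace ℝ (Fin d)) (Δt : ℝ) (Y : Fin s → EuclideanSpace ℝ (Fin d)) : Prop :=
  ∀ i, Y i = y + Δt • ∑ j, ∑ ν, M.a ν i j y Δt • f ν (Y j)

/-- The output `y + Δt ∑_j ∑_ν b_j^[ν](y, Δt) f^[ν](Y j)` of one step with the stages `Y`. -/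
def output (M : NSARK d N s)
    (f : Fin N → EuclideanSpace ℝ (Fin d) → EuclideanSpace ℝ (Fin d))
    (y : EuclideanSpace ℝ (Fin d)) (Δt : ℝ) (Y : Fin s → EuclideanSpace ℝ (Fin d)) :
    EuclideanSpace ℝ (Fin d) :=
  y + Δt • ∑ j, ∑ ν, M.b ν j y Δt • f ν (Y j)

/-- The coefficient `g_i^[ν](τ, y, Δt)`. -/
def g (M : NSARK d N s) (i : Fin s) (ν : Fin N) (τ : ColoredTree N)
    (y : EuclideanSpace ℝ (Fin d)) (Δt : ℝ) : ℝ :=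
  Quotient.lift (OrderedTree.g fun κ i j => M.a κ i j y Δt)
    (fun _ _ h => OrderedTree.g_congr _ h) τ i ν

/-- The coefficient `d_i(τ, y, Δt) = ∑_ν ∑_j a_{ij}^[ν](y, Δt) g_j^[ν](τ, y, Δt)`. -/
def stageCoeff (M : NSARK d N s) (i : Fin s) (τ : ColoredTree N)
    (y : EuclideanSpace ℝ (Fin d)) (Δt : ℝ) : ℝ :=
  ∑ ν, ∑ j, M.a ν i j y Δt * M.g j ν τ y Δt

/-- The coefficient `u(τ, y, Δt) = ∑_ν ∑_i b_i^[ν](y, Δt) g_i^[ν](τ, y, Δt)`. -/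
def u (M : NSARK d N s) (τ : ColoredTree N) (y : EuclideanSpace ℝ (Fin d)) (Δt : ℝ) : ℝ :=
  ∑ ν, ∑ i, M.b ν i y Δt * M.g i ν τ y Δt

/-- The recursion `g_i^[ν]([τ₁,…,τₖ]^[μ]) = δ_{νμ} ∏ₘ d_i(τₘ)`. -/
theorem g_node (M : NSARK d N s) (i : Fin s) (ν μ : Fin N) (k : ℕ) (c : Fin k → OrderedTree N)
    (y : EuclideanSpace ℝ (Fin d)) (Δt : ℝ) :
    M.g i ν (Quotient.mk _ (OrderedTree.node μ k c)) y Δt =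
      (if ν = μ then 1 else 0) * ∏ m, M.stageCoeff i (Quotient.mk _ (c m)) y Δt :=
  rfl

end NSARK

end

/-! The coefficients may depend on `Δt` in any bounded way, so nothing can be differentiated in
`Δt`; every step is an estimate as `Δt → 0⁺`. The Lipschitz bound and the bounded `a` confine every
family of stage solutions to an `O(Δt)` neighbourhood of `y` (`isBigO_stage_sub`).

The expansion of `Δt f^[ν](Y i)` is then raised one order at a time. If it holds up to
`O(Δt^(q+1))`, the stage equations, being linear in these quantities, give the stages to the same
accuracy (`isBigO_stage_sub_nbSum`). Inserting them into the degree `q` Taylor polynomial of `f^[ν]`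
at `y` costs `O(Δt^(q+1))`, and the outer factor `Δt` gains the next order. At order `p`, linear
combination gives the stages and the output.

It remains to recognise the series (`isBigO_taylor_nbSum`). By multilinearity the `k`-th Taylor term
is a sum over `k`-tuples of trees, to be read as the children of a root of color `ν`. A tree whose
root has `k` children with multiplicities `m_j` comes from `k! / ∏ m_j!` tuples
(`card_image_comp_perm_mul`), which turns `1/k!` and the inverse symmetries of the children into
`1/σ(τ)` (`sum_upTo_succ`). Equal contributions from reordered tuples rest on the symmetry of higher
derivatives. -/

open Filter Topology Asymptotics
open scoped Nat

/-! ### Symmetry of higher derivatives and Taylor's theorem -/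

section SymmetricDerivatives

variable {E F : Type*} [NormedAddCommGroup E] [NormedSpace ℝ E] [NormedAddCommGroup F]
  [NormedSpace ℝ F]

/-- Swapping the first two arguments is the symmetry of the second derivative of a lower iterated
derivative. A later swap leaves the first argument fixed, so it follows by differentiating the
identity of one order less, known at every point. -/
theorem ContDiff.iteratedFDeriv_comp_swap {n : ℕ} {f : E → F} (hf : ContDiff ℝ n f) :
    ∀ {k : ℕ}, k + 1 ≤ n → ∀ (x : E) (v : Fin (k + 1) → E) (i : Fin k),
      iteratedFDeriv ℝ (k + 1) f x (v ∘ Equiv.swap i.castSucc i.succ) =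
        iteratedFDeriv ℝ (k + 1) f x v
  | 0, _, _, _, i => i.elim0
  | m + 1, hk, x, v, i => by
    refine Fin.cases ?_ (fun j => ?_) i
    · have hsymm : IsSymmSndFDerivAt ℝ (iteratedFDeriv ℝ m f) x := by
        refine ContDiffAt.isSymmSndFDerivAt (n := 2) ?_ (by simp)
        exact (hf.iteratedFDeriv_right (m := 2) (i := m)
          (by norm_cast; omega)).contDiffAt
      have key : ∀ w : Fin (m + 1 + 1) → E, iteratedFDeriv ℝ (m + 1 + 1) f x w =
          fderiv ℝ (fderiv ℝ (iteratedFDeriv ℝ m f)) x (w 0) (w 1)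
            (fun l => w l.succ.succ) := by
        intro w
        -- The derivative of order `m + 1` is `L` applied to `fderiv` of the one of order `m`; being
        -- linear, `L` commutes with a further `fderiv`.
        let L : (E →L[ℝ] (E [×m]→L[ℝ] F)) ≃L[ℝ] (E [×(m + 1)]→L[ℝ] F) :=
          (continuousMultilinearCurryLeftEquiv ℝ (fun _ : Fin (m + 1) => E)
            F).symm.toContinuousLinearEquiv
        have hL := ContinuousLinearEquiv.comp_fderiv (𝕜 := ℝ) L
          (f := fderiv ℝ (iteratedFDeriv ℝ m f)) (x := x)
        rw [iteratedFDeriv_succ_apply_left]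
        exact congrArg (fun A : E →L[ℝ] (E [×(m + 1)]→L[ℝ] F) => A (w 0) (Fin.tail w)) hL
      rw [key, key, hsymm]
      congr 1
    · have hdiff : DifferentiableAt ℝ (iteratedFDeriv ℝ (m + 1) f) x :=
        (hf.differentiable_iteratedFDeriv (by norm_cast)).differentiableAt
      rw [hdiff.iteratedFDeriv_succ_apply_left', hdiff.iteratedFDeriv_succ_apply_left']
      have h0 : (v ∘ Equiv.swap j.succ.castSucc j.succ.succ) 0 = v 0 := by
        simp only [Function.comp_apply]
        rw [Equiv.swap_apply_of_ne_of_ne]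
        · exact (Fin.castSucc_ne_zero_iff.2 (Fin.succ_ne_zero j)).symm
        · exact (Fin.succ_ne_zero _).symm
      have ht : Fin.tail (v ∘ Equiv.swap j.succ.castSucc j.succ.succ) =
          Fin.tail v ∘ Equiv.swap j.castSucc j.succ := by
        funext l
        simp only [Fin.tail, Function.comp_apply]
        rw [Fin.castSucc_succ, ← (Fin.succ_injective _).map_swap]
      rw [h0, ht]
      congr 2
      funext z
      exact ContDiff.iteratedFDeriv_comp_swap hf (by omega) z (Fin.tail v) j

/-- The iterated derivatives of a `C^n` map are symmetric up to order `n`. -/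
theorem ContDiff.iteratedFDeriv_comp_perm {n : ℕ} {f : E → F} (hf : ContDiff ℝ n f) {k : ℕ}
    (hk : k ≤ n) (x : E) (v : Fin k → E) (e : Equiv.Perm (Fin k)) :
    iteratedFDeriv ℝ k f x (v ∘ e) = iteratedFDeriv ℝ k f x v := by
  cases k with
  | zero => congr 1; exact Subsingleton.elim _ _
  | succ k =>
    -- Adjacent transpositions generate all permutations, even as a monoid.
    have he : e ∈ Submonoid.closure
        (Set.range fun i : Fin k => Equiv.swap i.castSucc i.succ) := by
      rw [Equiv.Perm.mclosure_swap_castSucc_succ]; trivial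
    induction he using Submonoid.closure_induction generalizing v with
    | mem e he =>
      obtain ⟨i, rfl⟩ := he
      exact hf.iteratedFDeriv_comp_swap hk x v i
    | one => rfl
    | mul e e' _ _ h h' =>
      rw [Equiv.Perm.coe_mul, ← Function.comp_assoc, h', h]

/-- Taylor's theorem with a remainder that is bounded by a power of the increment. -/
theorem ContDiff.taylor_isBigO [ProperSpace E] [CompleteSpace F] {n : ℕ} {f : E → F}
    (hf : ContDiff ℝ (n + 1 : ℕ) f) (x : E) :
    (fun z : E => f (x + z) -
      ∑ k ∈ Finset.range (n + 1), (k ! : ℝ)⁻¹ • iteratedFDeriv ℝ k f x (fun _ => z))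
      =O[𝓝 0] (fun z => ‖z‖ ^ (n + 1)) := by
  have hcont : Continuous (iteratedFDeriv ℝ (n + 1) f) := hf.continuous_iteratedFDeriv le_rfl
  -- Compactness of the unit ball bounds the top derivative in the integral remainder uniformly.
  obtain ⟨C, hC⟩ := (isCompact_closedBall x 1).exists_bound_of_continuousOn hcont.continuousOn
  refine IsBigO.of_bound ((n ! : ℝ)⁻¹ * C) ?_
  filter_upwards [Metric.ball_mem_nhds (0 : E) one_pos] with z hz
  have hz1 : ‖z‖ ≤ 1 := by simpa using (mem_ball_zero_iff.1 hz).le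
  rw [map_add_eq_sum_add_integral_iteratedFDeriv (f := f) (x := x) (y := z) (n := n)
    (fun t _ => by exact_mod_cast hf.contDiffAt), add_sub_cancel_left, norm_smul]
  have hI : ‖∫ t in (0 : ℝ)..1, (1 - t) ^ n • iteratedFDeriv ℝ (n + 1) f (x + t • z) (fun _ => z)‖
      ≤ (C * ‖z‖ ^ (n + 1)) * |1 - 0| := by
    refine intervalIntegral.norm_integral_le_of_norm_le_const fun t ht => ?_
    rw [Set.uIoc_of_le zero_le_one] at ht
    have ht1 : ‖(1 - t) ^ n‖ ≤ 1 := by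
      rw [norm_pow, Real.norm_of_nonneg (by linarith [ht.2])]
      exact pow_le_one₀ (by linarith [ht.2]) (by linarith [ht.1])
    have hmem : x + t • z ∈ Metric.closedBall x 1 := by
      rw [mem_closedBall_iff_norm, add_sub_cancel_left, norm_smul, Real.norm_of_nonneg ht.1.le]
      exact mul_le_one₀ ht.2 (norm_nonneg _) hz1
    rw [norm_smul]
    calc _ ≤ 1 * ‖iteratedFDeriv ℝ (n + 1) f (x + t • z) (fun _ => z)‖ := by gcongr
      _ ≤ ‖iteratedFDeriv ℝ (n + 1) f (x + t • z)‖ * ‖z‖ ^ (n + 1) := by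
        rw [one_mul]
        simpa using (iteratedFDeriv ℝ (n + 1) f (x + t • z)).le_opNorm (fun _ => z)
      _ ≤ _ := by gcongr; exact hC _ hmem
  simp only [sub_zero, abs_one, mul_one] at hI
  rw [Real.norm_of_nonneg (by positivity), Real.norm_of_nonneg (by positivity), mul_assoc]
  gcongr

end SymmetricDerivatives

/-! ### Elementary differentials under reordering of children -/

namespace OrderedTree

variable {N : ℕ}

theorem one_le_order : ∀ t : OrderedTree N, 1 ≤ order t
  | node _ _ _ => by simp [order]

/-- In a tree of order at most `n + 1` every node has at most `n` children, so only derivatives of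
order at most `n` occur, and these are symmetric for `C^n` maps. -/
theorem elemDiff_congr {d n : ℕ}
    {f : Fin N → EuclideanSpace ℝ (Fin d) → EuclideanSpace ℝ (Fin d)}
    (hf : ∀ ν, ContDiff ℝ n (f ν)) (y : EuclideanSpace ℝ (Fin d)) :
    ∀ {t t' : OrderedTree N}, Iso t t' → order t ≤ n + 1 → elemDiff f t y = elemDiff f t' y
  | node μ k c, node μ' l c', ⟨h, e, H⟩, hn => by
    obtain rfl : k = l := by simpa using Fintype.card_congr e
    subst h
    have hsum : ∑ i, order (c i) ≤ n := by
      have h' : 1 + ∑ i, order (c i) ≤ n + 1 := hn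
      omega
    have hk : k ≤ n := by
      have : ∑ _i : Fin k, 1 ≤ ∑ i, order (c i) := Finset.sum_le_sum fun i _ => one_le_order _
      simp at this
      omega
    have hc : ∀ i, order (c i) ≤ n + 1 := fun i =>
      ((Finset.single_le_sum (f := fun i => order (c i)) (fun _ _ => Nat.zero_le _)
        (Finset.mem_univ i)).trans hsum).trans n.le_succ
    simp only [elemDiff]
    rw [← (hf μ).iteratedFDeriv_comp_perm hk y (fun i => elemDiff f (c' i) y) e]
    congr 1
    funext i
    exact elemDiff_congr hf y (H i) (hc i)

end OrderedTree

/-! ### Counting ordered tuples of children -/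

namespace ColoredTree

variable {N : ℕ}

/-- The tree with root color `ν` and children `c 0, …, c (k - 1)`. -/
noncomputable def node (ν : Fin N) (k : ℕ) (c : Fin k → ColoredTree N) : ColoredTree N :=
  Quotient.mk _ (OrderedTree.node ν k fun i => Quotient.out (c i))

theorem mk_out (τ : ColoredTree N) : (Quotient.mk _ (Quotient.out τ) : ColoredTree N) = τ :=
  Quotient.out_eq τ

theorem order_out (τ : ColoredTree N) : OrderedTree.order (Quotient.out τ) = order τ :=
  congrArg order (mk_out τ)

theorem symmetry_out (τ : ColoredTree N) : OrderedTree.symmetry (Quotient.out τ) = symmetry τ :=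
  congrArg symmetry (mk_out τ)

theorem one_le_order (τ : ColoredTree N) : 1 ≤ order τ :=
  (OrderedTree.one_le_order _).trans_eq (order_out τ)

theorem order_node (ν : Fin N) (k : ℕ) (c : Fin k → ColoredTree N) :
    order (node ν k c) = 1 + ∑ i, order (c i) :=
  congrArg (1 + ·) (Finset.sum_congr rfl fun i _ => order_out (c i))

theorem mem_upTo {q : ℕ} {τ : ColoredTree N} : τ ∈ upTo N q ↔ order τ ≤ q := by
  simp [upTo]

theorem exists_eq_node (τ : ColoredTree N) : ∃ ν k c, τ = node ν k c := by
  obtain ⟨t, rfl⟩ := Quotient.exists_rep τ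
  obtain ⟨ν, k, c⟩ := t
  refine ⟨ν, k, fun i => Quotient.mk _ (c i), Quotient.sound ⟨rfl, Equiv.refl _, fun i => ?_⟩⟩
  exact (Quotient.exact (mk_out (Quotient.mk _ (c i)))).symm

theorem node_eq_node_iff {ν μ : Fin N} {k l : ℕ} {c : Fin k → ColoredTree N}
    {c' : Fin l → ColoredTree N} :
    node ν k c = node μ l c' ↔ ν = μ ∧ ∃ e : Fin k ≃ Fin l, ∀ i, c i = c' (e i) := by
  constructor
  · intro h
    obtain ⟨h1, e, H⟩ := Quotient.exact h
    exact ⟨h1, e, fun i => by rw [← mk_out (c i), ← mk_out (c' (e i))]; exact Quotient.sound (H i)⟩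
  · rintro ⟨h, e, H⟩
    exact Quotient.sound ⟨h, e, fun i =>
      (congrArg (fun τ => OrderedTree.Iso (Quotient.out (c i)) (Quotient.out τ)) (H i)).mp
        (OrderedTree.Iso.refl _)⟩

open Classical in
theorem symmetry_node (ν : Fin N) (k : ℕ) (c : Fin k → ColoredTree N) :
    symmetry (node ν k c) = (∏ C ∈ Finset.univ.image c,
      (Finset.univ.filter (fun i => c i = C)).card !) * ∏ i, symmetry (c i) := by
  have hq : (fun i => (Quotient.mk _ (Quotient.out (c i)) : ColoredTree N)) = c :=
    funext fun i => mk_out (c i)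
  -- The two products may carry different decidability instances; the value does not depend on them.
  have hdec : ∀ {α : Type} (i₁ i₂ : DecidableEq α) (q : Fin k → α),
      ∏ C ∈ @Finset.image _ _ i₁ q Finset.univ,
        (@Finset.filter _ (fun i => q i = C) (fun _ => i₁ _ _) Finset.univ).card ! =
      ∏ C ∈ @Finset.image _ _ i₂ q Finset.univ,
        (@Finset.filter _ (fun i => q i = C) (fun _ => i₂ _ _) Finset.univ).card ! := by
    intro α i₁ i₂ q
    rw [Subsingleton.elim i₁ i₂]
  change OrderedTree.symmetry _ = _
  rw [OrderedTree.symmetry]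
  refine congrArg₂ (· * ·) ?_ (Finset.prod_congr rfl fun i _ => symmetry_out (c i))
  refine (hdec (α := Quotient (OrderedTree.setoid N)) _
    (fun a b => Classical.propDecidable (a = b)) _).trans ?_
  exact congrArg (fun q : Fin k → ColoredTree N =>
    ∏ C ∈ Finset.univ.image q, (Finset.univ.filter (fun i => q i = C)).card !) hq

theorem elemDiff_node {d n : ℕ}
    {f : Fin N → EuclideanSpace ℝ (Fin d) → EuclideanSpace ℝ (Fin d)}
    (hf : ∀ ν, ContDiff ℝ n (f ν)) (y : EuclideanSpace ℝ (Fin d)) (ν : Fin N) (k : ℕ)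
    (c : Fin k → ColoredTree N) (h : order (node ν k c) ≤ n + 1) :
    elemDiff f (node ν k c) y = iteratedFDeriv ℝ k (f ν) y (fun i => elemDiff f (c i) y) :=
  OrderedTree.elemDiff_congr hf y (Quotient.exact (mk_out (node ν k c))) ((order_out _).trans_le h)

-- Orbit–stabilizer for permutations of positions: the stabilizer of `c` permutes each level set of
-- `c` independently.
open Classical in
theorem card_image_comp_perm_mul {α : Type*} {k : ℕ} (c : Fin k → α) :
    (Finset.univ.image fun e : Equiv.Perm (Fin k) => c ∘ e).card *
      ∏ C ∈ Finset.univ.image c, (Finset.univ.filter (fun i => c i = C)).card ! = k ! := by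
  have hstab : ∏ C ∈ Finset.univ.image c, (Finset.univ.filter (fun i => c i = C)).card ! =
      (Finset.univ.filter fun e : Equiv.Perm (Fin k) => c ∘ e = c).card := by
    rw [← Fintype.card_subtype, DomMulAct.stabilizer_card']
    simp only [Fintype.card_subtype]
  have hk : k ! = (Finset.univ : Finset (Equiv.Perm (Fin k))).card := by
    rw [Finset.card_univ, Fintype.card_perm, Fintype.card_fin]
  rw [hk, Finset.card_eq_sum_card_image (fun e : Equiv.Perm (Fin k) => c ∘ e), hstab,
    ← smul_eq_mul, ← Finset.sum_const]
  refine Finset.sum_congr rfl fun b hb => ?_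
  obtain ⟨e₀, -, rfl⟩ := Finset.mem_image.1 hb
  -- Right translation by `e₀` carries the stabilizer of `c` onto the fibre over `c ∘ e₀`.
  refine Finset.card_equiv (Equiv.mulRight e₀) fun e => ?_
  simp only [Finset.mem_filter, Finset.mem_univ, true_and, Equiv.coe_mulRight,
    Equiv.Perm.coe_mul, ← Function.comp_assoc]
  exact e₀.surjective.injective_comp_right.eq_iff.symm

open Classical in
/-- A sum over the trees of order at most `q + 1`, weighted with inverse symmetries, as a sum over
the root colors and the tuples of children. -/
theorem sum_upTo_succ {V : Type*} [AddCommGroup V] [Module ℝ V] (q : ℕ) (Φ : ColoredTree N → V) :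
    ∑ τ ∈ upTo N (q + 1), (symmetry τ : ℝ)⁻¹ • Φ τ =
      ∑ ν, ∑ k ∈ Finset.range (q + 1), ∑ c ∈ (Fintype.piFinset fun _ : Fin k => upTo N q) with
        order (node ν k c) ≤ q + 1,
        ((k ! : ℝ)⁻¹ * ∏ i, (symmetry (c i) : ℝ)⁻¹) • Φ (node ν k c) := by
  let T : Finset (Σ _ : Fin N, Σ k : ℕ, Fin k → ColoredTree N) :=
    Finset.univ.sigma fun ν => (Finset.range (q + 1)).sigma fun k =>
      (Fintype.piFinset fun _ : Fin k => upTo N q).filter fun c => order (node ν k c) ≤ q + 1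
  -- The bounds on `k` and on the children only make `T` finite: they follow from the order bound,
  -- since the root and each child count at least one node.
  have hT : ∀ x, x ∈ T ↔ order (node x.1 x.2.1 x.2.2) ≤ q + 1 := by
    rintro ⟨ν, k, c⟩
    simp only [T, Finset.mem_sigma, Finset.mem_univ, Finset.mem_range, Finset.mem_filter,
      Fintype.mem_piFinset, mem_upTo, true_and]
    refine ⟨fun h => h.2.2, fun h => ⟨?_, fun i => ?_, h⟩⟩
    · rw [order_node] at h
      have : ∑ _i : Fin k, 1 ≤ ∑ i, order (c i) := Finset.sum_le_sum fun i _ => one_le_order _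
      simp at this
      omega
    · rw [order_node] at h
      have := Finset.single_le_sum (f := fun i => order (c i)) (fun _ _ => Nat.zero_le _)
        (Finset.mem_univ i)
      omega
  have hR : ∑ ν, ∑ k ∈ Finset.range (q + 1),
      ∑ c ∈ (Fintype.piFinset fun _ : Fin k => upTo N q) with order (node ν k c) ≤ q + 1,
        ((k ! : ℝ)⁻¹ * ∏ i, (symmetry (c i) : ℝ)⁻¹) • Φ (node ν k c) =
      ∑ x ∈ T, ((x.2.1 ! : ℝ)⁻¹ * ∏ i, (symmetry (x.2.2 i) : ℝ)⁻¹) •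
        Φ (node x.1 x.2.1 x.2.2) := by
    simp only [T, Finset.sum_sigma]
  rw [hR, ← Finset.sum_fiberwise_of_maps_to (t := upTo N (q + 1))
    (g := fun x => node x.1 x.2.1 x.2.2) (fun x hx => mem_upTo.2 ((hT x).1 hx))]
  refine Finset.sum_congr rfl fun τ hτ => ?_
  obtain ⟨ν, k, c, rfl⟩ := exists_eq_node τ
  -- The tuples producing a given tree form one permutation orbit, on which the summand is constant.
  have hfib : T.filter (fun x => node x.1 x.2.1 x.2.2 = node ν k c) =
      (Finset.univ.image fun e : Equiv.Perm (Fin k) => c ∘ e).image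
        (fun c' => (⟨ν, k, c'⟩ : Σ _ : Fin N, Σ k : ℕ, Fin k → ColoredTree N)) := by
    ext ⟨μ, l, c'⟩
    simp only [Finset.mem_filter, hT, Finset.mem_image, Finset.mem_univ, true_and,
      exists_exists_eq_and]
    constructor
    · rintro ⟨-, h⟩
      obtain ⟨rfl, e, H⟩ := node_eq_node_iff.1 h
      obtain rfl : l = k := by simpa using Fintype.card_congr e
      refine ⟨e, ?_⟩
      rw [show c ∘ e = c' from funext fun i => (H i).symm]
    · rintro ⟨e, h⟩
      cases h
      have : node ν k (c ∘ e) = node ν k c := node_eq_node_iff.2 ⟨rfl, e, fun _ => rfl⟩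
      simpa [this] using mem_upTo.1 hτ
  rw [hfib, Finset.sum_image (fun a _ b _ h => by
    have := Sigma.mk.inj h
    exact eq_of_heq (Sigma.mk.inj (eq_of_heq this.2)).2)]
  have hconst : ∀ c' ∈ Finset.univ.image fun e : Equiv.Perm (Fin k) => c ∘ e,
      ((k ! : ℝ)⁻¹ * ∏ i, (symmetry (c' i) : ℝ)⁻¹) • Φ (node ν k c') =
      ((k ! : ℝ)⁻¹ * ∏ i, (symmetry (c i) : ℝ)⁻¹) • Φ (node ν k c) := by
    intro c' hc'
    obtain ⟨e, -, rfl⟩ := Finset.mem_image.1 hc'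
    have h1 : node ν k (c ∘ e) = node ν k c := node_eq_node_iff.2 ⟨rfl, e, fun _ => rfl⟩
    rw [h1]
    congr 2
    exact Equiv.prod_comp e fun i => (symmetry (c i) : ℝ)⁻¹
  rw [Finset.sum_congr rfl hconst, Finset.sum_const, ← Nat.cast_smul_eq_nsmul ℝ, smul_smul]
  congr 1
  rw [symmetry_node, ← card_image_comp_perm_mul c]
  have hm : ((∏ C ∈ Finset.univ.image c,
      (Finset.univ.filter (fun i => c i = C)).card ! : ℕ) : ℝ) ≠ 0 := by
    exact_mod_cast (Finset.prod_pos fun _ _ => Nat.factorial_pos _).ne'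
  have ho : ((Finset.univ.image fun e : Equiv.Perm (Fin k) => c ∘ e).card : ℝ) ≠ 0 := by
    exact_mod_cast (Finset.card_pos.2 (Finset.univ_nonempty.image _)).ne'
  rw [Nat.cast_mul, Nat.cast_mul, Nat.cast_prod (f := fun i => symmetry (c i)), mul_inv, mul_inv,
    Finset.prod_inv_distrib]
  field_simp

end ColoredTree

/-! ### Order estimates and truncated NB-series -/

section Asymptotics

theorem isBigO_pow_pow_nhdsGT {m n : ℕ} (h : m ≤ n) :
    (fun t : ℝ => t ^ n) =O[𝓝[>] 0] (fun t => t ^ m) := by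
  rcases h.eq_or_lt with rfl | h
  · exact isBigO_refl _ _
  · exact (isLittleO_pow_pow h).isBigO.mono nhdsWithin_le_nhds

theorem ContinuousMultilinearMap.isBigO_diagonal_sub {E F : Type*} [NormedAddCommGroup E]
    [NormedSpace ℝ E] [NormedAddCommGroup F] [NormedSpace ℝ F] {k : ℕ}
    (A : ContinuousMultilinearMap ℝ (fun _ : Fin k => E) F) {α : Type*} {l : Filter α}
    {u v : α → E} {ψ : α → ℝ} (hu : u =O[l] (fun _ => (1 : ℝ))) (hv : v =O[l] (fun _ => (1 : ℝ)))
    (huv : (fun x => u x - v x) =O[l] ψ) :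
    (fun x => A (fun _ => u x) - A (fun _ => v x)) =O[l] ψ := by
  obtain ⟨C, hC⟩ := hu.bound
  obtain ⟨D, hD⟩ := hv.bound
  refine IsBigO.trans (IsBigO.of_bound
    (‖A‖ * k * (max C D) ^ (k - 1)) ?_) huv
  filter_upwards [hC, hD] with x hx hx'
  simp only [norm_one, mul_one] at hx hx'
  have hM : 0 ≤ max C D := (norm_nonneg _).trans (hx.trans (le_max_left _ _))
  have h1 := A.norm_image_sub_le (fun _ => u x) (fun _ => v x)
  rw [Fintype.card_fin] at h1
  refine h1.trans ?_
  have h2 : max ‖fun _ : Fin k => u x‖ ‖fun _ : Fin k => v x‖ ≤ max C D :=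
    max_le_max ((pi_norm_const_le _).trans hx) ((pi_norm_const_le _).trans hx')
  have h3 : ‖(fun _ : Fin k => u x) - fun _ => v x‖ ≤ ‖u x - v x‖ :=
    pi_norm_const_le (ι := Fin k) (u x - v x)
  gcongr

end Asymptotics

section NBSeries

variable {d N s : ℕ}

theorem nbSum_sum_mul (f : Fin N → EuclideanSpace ℝ (Fin d) → EuclideanSpace ℝ (Fin d)) (q : ℕ)
    (c : Fin N → Fin s → ℝ) (w : Fin s → Fin N → ColoredTree N → ℝ)
    (y : EuclideanSpace ℝ (Fin d)) (h : ℝ) :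
    nbSum f q (fun τ => ∑ ν, ∑ j, c ν j * w j ν τ) y h =
      ∑ j, ∑ ν, c ν j • nbSum f q (w j ν) y h := by
  simp only [nbSum, Finset.smul_sum, Finset.mul_sum, Finset.sum_smul, smul_smul]
  rw [Finset.sum_comm]
  refine (Finset.sum_congr rfl fun ν _ => Finset.sum_comm).trans ?_
  rw [Finset.sum_comm]
  exact Finset.sum_congr rfl fun j _ => Finset.sum_congr rfl fun ν _ =>
    Finset.sum_congr rfl fun τ _ => by congr 1; ring

/-- Every tree has at least one node, so each summand carries a factor `Δt`. -/
theorem isBigO_nbSum (f : Fin N → EuclideanSpace ℝ (Fin d) → EuclideanSpace ℝ (Fin d)) (q : ℕ)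
    {w : ColoredTree N → ℝ → ℝ} (hw : ∀ τ, w τ =O[𝓝[>] 0] (fun _ => (1 : ℝ)))
    (y : EuclideanSpace ℝ (Fin d)) :
    (fun h => nbSum f q (fun τ => w τ h) y h) =O[𝓝[>] 0] (fun h => h) := by
  unfold nbSum
  refine IsBigO.fun_sum fun τ _ => ?_
  have h1 : (fun h : ℝ => h ^ τ.order) =O[𝓝[>] 0] (fun h => h) := by
    simpa using isBigO_pow_pow_nhdsGT τ.one_le_order
  have h2 : (fun h : ℝ => h ^ τ.order / (τ.symmetry : ℝ) * w τ h) =O[𝓝[>] 0] (fun h => h) := by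
    simpa [div_eq_inv_mul] using (h1.const_mul_left (τ.symmetry : ℝ)⁻¹).mul (hw τ)
  simpa using h2.smul (isBigO_const_const (τ.elemDiff f y) (one_ne_zero (α := ℝ)) (𝓝[>] 0))

end NBSeries

/-! ### Bounded coefficients and the a priori bound on the stages -/

namespace NSARK

variable {d N s : ℕ}

theorem g_coloredTree_node (M : NSARK d N s) (i : Fin s) (ν μ : Fin N) (k : ℕ)
    (c : Fin k → ColoredTree N) (y : EuclideanSpace ℝ (Fin d)) (Δt : ℝ) :
    M.g i ν (ColoredTree.node μ k c) y Δt =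
      (if ν = μ then 1 else 0) * ∏ m, M.stageCoeff i (c m) y Δt := by
  refine (M.g_node i ν μ k _ y Δt).trans ?_
  congr 1
  exact Finset.prod_congr rfl fun m _ =>
    congrArg (fun τ => M.stageCoeff i τ y Δt) (ColoredTree.mk_out (c m))

variable {M : NSARK d N s} {f : Fin N → EuclideanSpace ℝ (Fin d) → EuclideanSpace ℝ (Fin d)}
  {y : EuclideanSpace ℝ (Fin d)} {Y : ℝ → Fin s → EuclideanSpace ℝ (Fin d)}

theorem isBigO_stageCoeff_of_g
    (ha : ∀ ν i j, (fun Δt : ℝ => M.a ν i j y Δt) =O[𝓝[>] 0] (fun _ => (1 : ℝ)))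
    {τ : ColoredTree N}
    (hg : ∀ i ν, (fun Δt : ℝ => M.g i ν τ y Δt) =O[𝓝[>] 0] (fun _ => (1 : ℝ))) (i : Fin s) :
    (fun Δt : ℝ => M.stageCoeff i τ y Δt) =O[𝓝[>] 0] (fun _ => (1 : ℝ)) := by
  unfold stageCoeff
  exact IsBigO.fun_sum fun ν _ => IsBigO.fun_sum fun j _ => by
    simpa using (ha ν i j).mul (hg j ν)

theorem isBigO_g
    (ha : ∀ ν i j, (fun Δt : ℝ => M.a ν i j y Δt) =O[𝓝[>] 0] (fun _ => (1 : ℝ)))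
    (τ : ColoredTree N) (i : Fin s) (ν : Fin N) :
    (fun Δt : ℝ => M.g i ν τ y Δt) =O[𝓝[>] 0] (fun _ => (1 : ℝ)) := by
  obtain ⟨t, rfl⟩ := Quotient.exists_rep τ
  induction t generalizing i ν with
  | node μ k c ih =>
    have h := (IsBigO.finsetProd (s := Finset.univ) (fun m _ =>
      isBigO_stageCoeff_of_g ha (ih m) i)).const_mul_left (if ν = μ then 1 else 0)
    simp only [Finset.prod_const_one] at h
    exact h

theorem isBigO_stageCoeff
    (ha : ∀ ν i j, (fun Δt : ℝ => M.a ν i j y Δt) =O[𝓝[>] 0] (fun _ => (1 : ℝ)))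
    (τ : ColoredTree N) (i : Fin s) :
    (fun Δt : ℝ => M.stageCoeff i τ y Δt) =O[𝓝[>] 0] (fun _ => (1 : ℝ)) :=
  isBigO_stageCoeff_of_g ha (fun j ν => isBigO_g ha τ j ν) i

/-- The stages differ from the current approximation by `O(Δt)`. -/
theorem isBigO_stage_sub (hLip : ∀ ν, ∃ K, LipschitzWith K (f ν))
    (ha : ∀ ν i j, (fun Δt : ℝ => M.a ν i j y Δt) =O[𝓝[>] 0] (fun _ => (1 : ℝ)))
    (hY : ∀ᶠ Δt : ℝ in 𝓝[>] 0, M.IsStageSolution f y Δt (Y Δt)) (i : Fin s) :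
    (fun Δt => Y Δt i - y) =O[𝓝[>] 0] (fun Δt => Δt) := by
  -- The stages are coupled, so all of them are estimated together in the sup norm.
  let G : ℝ → ℝ := fun Δt => ‖fun j => Y Δt j - y‖
  have hf : ∀ ν j, (fun Δt => f ν (Y Δt j)) =O[𝓝[>] 0] (fun Δt => 1 + G Δt) := by
    intro ν j
    obtain ⟨K, hK⟩ := hLip ν
    refine IsBigO.of_bound (max ‖f ν y‖ K) (Eventually.of_forall fun Δt => ?_)
    have h1 : ‖f ν (Y Δt j) - f ν y‖ ≤ K * ‖Y Δt j - y‖ := hK.norm_sub_le _ _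
    have h2 : ‖Y Δt j - y‖ ≤ G Δt := norm_le_pi_norm (fun j => Y Δt j - y) j
    have h3 : ‖f ν (Y Δt j)‖ ≤ ‖f ν y‖ + ‖f ν (Y Δt j) - f ν y‖ := norm_le_norm_add_norm_sub' _ _
    have hG : 0 ≤ G Δt := norm_nonneg _
    rw [Real.norm_of_nonneg (by linarith)]
    calc ‖f ν (Y Δt j)‖ ≤ ‖f ν y‖ * 1 + K * G Δt := by
          have : (K : ℝ) * ‖Y Δt j - y‖ ≤ K * G Δt := by gcongr
          linarith
      _ ≤ max ‖f ν y‖ K * 1 + max ‖f ν y‖ K * G Δt := by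
          gcongr
          · exact le_max_left _ _
          · exact le_max_right _ _
      _ = _ := by ring
  have hstage : ∀ j, (fun Δt => Y Δt j - y) =O[𝓝[>] 0] (fun Δt => Δt * (1 + G Δt)) := by
    intro j
    have hsum : (fun Δt => ∑ l, ∑ ν, M.a ν j l y Δt • f ν (Y Δt l)) =O[𝓝[>] 0]
        (fun Δt => 1 + G Δt) :=
      IsBigO.fun_sum fun l _ => IsBigO.fun_sum fun ν _ => by
        simpa using (ha ν j l).smul (hf ν l)
    refine ((isBigO_refl (fun Δt : ℝ => Δt) _).smul hsum).congr' ?_ EventuallyEq.rfl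
    filter_upwards [hY] with Δt h
    rw [h j, add_sub_cancel_left]
  obtain ⟨C, hCpos, hC⟩ := (isBigO_pi.2 hstage).exists_pos
  -- With `C Δt ≤ 1/2`, the bound `G ≤ C Δt (1 + G)` lets `G / 2` be absorbed on the left, whence `G
  -- ≤ 2 C Δt`.
  have hsmall : ∀ᶠ Δt : ℝ in 𝓝[>] 0, Δt < 1 / (2 * C) :=
    nhdsWithin_le_nhds (Iio_mem_nhds (by positivity))
  have hG : G =O[𝓝[>] 0] (fun Δt => Δt) := by
    refine IsBigO.of_bound (2 * C) ?_
    filter_upwards [hC.bound, hsmall, self_mem_nhdsWithin] with Δt h1 h2 h3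
    have hpos : (0 : ℝ) < Δt := h3
    have hG0 : 0 ≤ G Δt := norm_nonneg _
    have h4 : G Δt ≤ C * ‖Δt * (1 + G Δt)‖ := h1
    rw [Real.norm_of_nonneg (by positivity)] at h4
    rw [Real.norm_of_nonneg hG0, Real.norm_of_nonneg hpos.le]
    have h5 : C * Δt ≤ 1 / 2 := by
      rw [lt_div_iff₀ (by positivity)] at h2
      linarith
    nlinarith
  exact isBigO_pi.1 (isBigO_norm_left.1 hG) i

/-! ### Raising the order of the expansions -/

/-- Expansions of the scaled stage derivatives carry over to their linear combinations. -/
theorem isBigO_sum_sub_nbSum {q : ℕ} {c : Fin N → Fin s → ℝ → ℝ}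
    (hc : ∀ ν j, c ν j =O[𝓝[>] 0] (fun _ => (1 : ℝ)))
    (hg : ∀ i ν, (fun Δt : ℝ => Δt • f ν (Y Δt i) - nbSum f q (fun τ => M.g i ν τ y Δt) y Δt)
      =O[𝓝[>] 0] (fun Δt => Δt ^ (q + 1))) :
    (fun Δt : ℝ => Δt • ∑ j, ∑ ν, c ν j Δt • f ν (Y Δt j) -
      nbSum f q (fun τ => ∑ ν, ∑ j, c ν j Δt * M.g j ν τ y Δt) y Δt)
      =O[𝓝[>] 0] (fun Δt => Δt ^ (q + 1)) := by
  have h : (fun Δt : ℝ => ∑ j, ∑ ν, c ν j Δt •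
      (Δt • f ν (Y Δt j) - nbSum f q (fun τ => M.g j ν τ y Δt) y Δt))
      =O[𝓝[>] 0] (fun Δt => Δt ^ (q + 1)) :=
    IsBigO.fun_sum fun j _ => IsBigO.fun_sum fun ν _ => by
      simpa using (hc ν j).smul (hg j ν)
  refine h.congr_left fun Δt => ?_
  rw [nbSum_sum_mul f q (fun ν j => c ν j Δt) (fun j ν τ => M.g j ν τ y Δt)]
  simp only [smul_sub, Finset.sum_sub_distrib, Finset.smul_sum, smul_comm Δt]

theorem isBigO_stage_sub_nbSum {q : ℕ}
    (ha : ∀ ν i j, (fun Δt : ℝ => M.a ν i j y Δt) =O[𝓝[>] 0] (fun _ => (1 : ℝ)))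
    (hY : ∀ᶠ Δt : ℝ in 𝓝[>] 0, M.IsStageSolution f y Δt (Y Δt))
    (hg : ∀ i ν, (fun Δt : ℝ => Δt • f ν (Y Δt i) - nbSum f q (fun τ => M.g i ν τ y Δt) y Δt)
      =O[𝓝[>] 0] (fun Δt => Δt ^ (q + 1))) (i : Fin s) :
    (fun Δt : ℝ => Y Δt i - (y + nbSum f q (fun τ => M.stageCoeff i τ y Δt) y Δt))
      =O[𝓝[>] 0] (fun Δt => Δt ^ (q + 1)) := by
  refine (isBigO_sum_sub_nbSum (c := fun ν j Δt => M.a ν i j y Δt) (fun ν j => ha ν i j)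
    hg).congr' ?_ EventuallyEq.rfl
  filter_upwards [hY] with Δt h
  rw [h i, add_sub_add_left_eq_sub]
  rfl

/-- Inserting the truncated series of a stage into the truncated Taylor polynomial of `f ν`
reproduces the truncated series of the scaled stage derivative. -/
theorem isBigO_taylor_nbSum {p q : ℕ} (hq : q ≤ p) (hf : ∀ ν, ContDiff ℝ p (f ν))
    (ha : ∀ ν i j, (fun Δt : ℝ => M.a ν i j y Δt) =O[𝓝[>] 0] (fun _ => (1 : ℝ)))
    (i : Fin s) (ν : Fin N) :
    (fun Δt : ℝ => Δt • ∑ k ∈ Finset.range (q + 1), (k ! : ℝ)⁻¹ • iteratedFDeriv ℝ k (f ν) y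
        (fun _ => nbSum f q (fun τ => M.stageCoeff i τ y Δt) y Δt) -
      nbSum f (q + 1) (fun τ => M.g i ν τ y Δt) y Δt)
      =O[𝓝[>] 0] (fun Δt => Δt ^ (q + 1 + 1)) := by
  -- The contribution of one tuple of children. The outer `Δt` supplies the root in the exponent `1
  -- + ∑ |c m|`.
  let W : (k : ℕ) → (Fin k → ColoredTree N) → ℝ → EuclideanSpace ℝ (Fin d) := fun k c Δt =>
    ((k ! : ℝ)⁻¹ * ∏ m, ((c m).symmetry : ℝ)⁻¹) •
      (Δt ^ (ColoredTree.node ν k c).order * ∏ m, M.stageCoeff i (c m) y Δt) •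
        iteratedFDeriv ℝ k (f ν) y (fun m => (c m).elemDiff f y)
  have hleft : ∀ Δt : ℝ, Δt • ∑ k ∈ Finset.range (q + 1), (k ! : ℝ)⁻¹ •
      iteratedFDeriv ℝ k (f ν) y (fun _ => nbSum f q (fun τ => M.stageCoeff i τ y Δt) y Δt) =
      ∑ k ∈ Finset.range (q + 1),
        ∑ c ∈ Fintype.piFinset fun _ : Fin k => ColoredTree.upTo N q, W k c Δt := by
    intro Δt
    rw [Finset.smul_sum]
    refine Finset.sum_congr rfl fun k _ => ?_
    simp only [nbSum]
    rw [ContinuousMultilinearMap.map_sum_finset, Finset.smul_sum, Finset.smul_sum]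
    refine Finset.sum_congr rfl fun c _ => ?_
    rw [ContinuousMultilinearMap.map_smul_univ]
    simp only [W, smul_smul, ColoredTree.order_node, pow_add, pow_one, div_eq_mul_inv,
      Finset.prod_mul_distrib, Finset.prod_pow_eq_pow_sum]
    congr 1
    ring
  have hright : ∀ Δt : ℝ, nbSum f (q + 1) (fun τ => M.g i ν τ y Δt) y Δt =
      ∑ k ∈ Finset.range (q + 1),
        ∑ c ∈ (Fintype.piFinset fun _ : Fin k => ColoredTree.upTo N q) with
          (ColoredTree.node ν k c).order ≤ q + 1, W k c Δt := by
    intro Δt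
    have h := ColoredTree.sum_upTo_succ q
      (fun τ : ColoredTree N => (Δt ^ τ.order * M.g i ν τ y Δt) • τ.elemDiff f y)
    have h0 : nbSum f (q + 1) (fun τ => M.g i ν τ y Δt) y Δt =
        ∑ τ ∈ ColoredTree.upTo N (q + 1), (τ.symmetry : ℝ)⁻¹ •
          (Δt ^ τ.order * M.g i ν τ y Δt) • τ.elemDiff f y :=
      Finset.sum_congr rfl fun τ _ => by rw [smul_smul]; congr 1; ring
    -- The Kronecker delta in `g` leaves only trees with root color `ν`.
    rw [h0, h, Finset.sum_eq_single ν]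
    · refine Finset.sum_congr rfl fun k _ => Finset.sum_congr rfl fun c hc => ?_
      have hord := (Finset.mem_filter.1 hc).2
      simp only [W]
      rw [ColoredTree.elemDiff_node hf y ν k c (hord.trans (by omega)), g_coloredTree_node,
        if_pos rfl, one_mul]
    · intro μ _ hμ
      refine Finset.sum_eq_zero fun k _ => Finset.sum_eq_zero fun c _ => ?_
      rw [g_coloredTree_node, if_neg hμ.symm]
      simp
    · simp
  have hdiff : ∀ Δt : ℝ, Δt • ∑ k ∈ Finset.range (q + 1), (k ! : ℝ)⁻¹ •
      iteratedFDeriv ℝ k (f ν) y (fun _ => nbSum f q (fun τ => M.stageCoeff i τ y Δt) y Δt) -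
      nbSum f (q + 1) (fun τ => M.g i ν τ y Δt) y Δt =
      ∑ k ∈ Finset.range (q + 1),
        ∑ c ∈ (Fintype.piFinset fun _ : Fin k => ColoredTree.upTo N q) with
          ¬ (ColoredTree.node ν k c).order ≤ q + 1, W k c Δt := by
    intro Δt
    rw [hleft, hright, ← Finset.sum_sub_distrib]
    refine Finset.sum_congr rfl fun k _ => ?_
    rw [sub_eq_iff_eq_add', Finset.sum_filter_add_sum_filter_not]
  simp only [hdiff]
  -- What remains are finitely many tuples whose tree has at least `q + 2` nodes.
  refine IsBigO.fun_sum fun k _ => IsBigO.fun_sum fun c hc => ?_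
  have hord := (Finset.mem_filter.1 hc).2
  have h1 : (fun Δt : ℝ => Δt ^ (ColoredTree.node ν k c).order) =O[𝓝[>] 0]
      (fun Δt => Δt ^ (q + 1 + 1)) := isBigO_pow_pow_nhdsGT (by omega)
  have h2 := IsBigO.finsetProd (s := Finset.univ) (fun m _ => isBigO_stageCoeff ha (c m) i)
  have h3 := ((h1.mul h2).smul (isBigO_const_const
    (iteratedFDeriv ℝ k (f ν) y (fun m => (c m).elemDiff f y)) (one_ne_zero (α := ℝ))
      (𝓝[>] 0))).const_smul_left ((k ! : ℝ)⁻¹ * ∏ m, ((c m).symmetry : ℝ)⁻¹)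
  simp only [Finset.prod_const_one, mul_one, smul_eq_mul] at h3
  exact h3

/-- The expansions of the scaled stage derivatives. -/
theorem isBigO_smul_sub_nbSum {p : ℕ} (hf : ∀ ν, ContDiff ℝ p (f ν))
    (hLip : ∀ ν, ∃ K, LipschitzWith K (f ν))
    (ha : ∀ ν i j, (fun Δt : ℝ => M.a ν i j y Δt) =O[𝓝[>] 0] (fun _ => (1 : ℝ)))
    (hY : ∀ᶠ Δt : ℝ in 𝓝[>] 0, M.IsStageSolution f y Δt (Y Δt)) :
    ∀ q ≤ p, ∀ i ν,
      (fun Δt : ℝ => Δt • f ν (Y Δt i) - nbSum f q (fun τ => M.g i ν τ y Δt) y Δt)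
        =O[𝓝[>] 0] (fun Δt => Δt ^ (q + 1)) := by
  have hsub := isBigO_stage_sub hLip ha hY
  have hid : Tendsto (fun Δt : ℝ => Δt) (𝓝[>] 0) (𝓝 0) := nhdsWithin_le_nhds
  have hone : (fun Δt : ℝ => Δt) =O[𝓝[>] 0] (fun _ => (1 : ℝ)) := hid.isBigO_one ℝ
  have htend : ∀ i, Tendsto (fun Δt => Y Δt i - y) (𝓝[>] 0) (𝓝 0) := fun i =>
    (hsub i).trans_tendsto hid
  intro q
  induction q with
  | zero =>
    intro _ i ν
    -- No tree has order `0`, so the base case only asks that `f^[ν](Y i)` stay bounded.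
    have hempty : ColoredTree.upTo N 0 = ∅ := Finset.eq_empty_of_forall_notMem fun τ hτ => by
      have := ColoredTree.mem_upTo.1 hτ
      have := τ.one_le_order
      omega
    have hcont : Tendsto (fun Δt => f ν (Y Δt i)) (𝓝[>] 0) (𝓝 (f ν y)) := by
      have := ((hf ν).continuous.tendsto y).comp (tendsto_sub_nhds_zero_iff.1 (htend i))
      exact this
    simpa [nbSum, hempty] using
      (isBigO_refl (fun Δt : ℝ => Δt) (𝓝[>] 0)).smul (hcont.isBigO_one ℝ)
  | succ q ih =>
    intro hq i ν
    have hg := ih (by omega)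
    have hstage := isBigO_stage_sub_nbSum ha hY hg i
    have hD := (isBigO_nbSum f q (fun τ => isBigO_stageCoeff ha τ i) y).trans hone
    -- The remainder needs `q + 1 ≤ p` derivatives; the a priori bound turns its power of the
    -- increment into one of `Δt`.
    have htaylor : (fun Δt : ℝ => f ν (y + (Y Δt i - y)) - ∑ k ∈ Finset.range (q + 1),
        (k ! : ℝ)⁻¹ • iteratedFDeriv ℝ k (f ν) y (fun _ => Y Δt i - y))
        =O[𝓝[>] 0] (fun Δt => Δt ^ (q + 1)) := ((((hf ν).of_le (by exact_mod_cast hq)).taylor_isBigO (n := q) y).comp_tendsto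
      (htend i)).trans ((hsub i).norm_left.pow (q + 1))
    have hpoly : (fun Δt : ℝ => ∑ k ∈ Finset.range (q + 1), ((k ! : ℝ)⁻¹ •
        iteratedFDeriv ℝ k (f ν) y (fun _ => Y Δt i - y) - (k ! : ℝ)⁻¹ •
        iteratedFDeriv ℝ k (f ν) y (fun _ => nbSum f q (fun τ => M.stageCoeff i τ y Δt) y Δt)))
        =O[𝓝[>] 0] (fun Δt => Δt ^ (q + 1)) := by
      refine IsBigO.fun_sum fun k _ => ?_
      have hk := (iteratedFDeriv ℝ k (f ν) y).isBigO_diagonal_sub ((hsub i).trans hone) hD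
        (by simpa only [sub_sub] using hstage)
      simp only [← smul_sub]
      exact hk.const_smul_left (k ! : ℝ)⁻¹
    -- Multiplication by `Δt` is what gains the order.
    have hsum := (isBigO_refl (fun Δt : ℝ => Δt) (𝓝[>] 0)).smul (htaylor.add hpoly)
    simp only [smul_eq_mul, ← pow_succ'] at hsum
    refine (hsum.add (isBigO_taylor_nbSum (by omega : q ≤ p) hf ha i ν)).congr_left fun Δt => ?_
    simp only [add_sub_cancel, Finset.sum_sub_distrib, smul_add, smul_sub]
    abel

end NSARK

theorem mainTheorem1 {d N s : ℕ} (p : ℕ) (M : NSARK d N s)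
    (f : Fin N → EuclideanSpace ℝ (Fin d) → EuclideanSpace ℝ (Fin d))
    (hf : ∀ ν, ContDiff ℝ ((p + 1 : ℕ) : WithTop ℕ∞) (f ν))
    (hLip : ∀ ν, ∃ K, LipschitzWith K (f ν))
    (y : EuclideanSpace ℝ (Fin d))
    (ha : ∀ ν i j, (fun Δt : ℝ => M.a ν i j y Δt) =O[𝓝[>] 0] (fun _ => (1 : ℝ)))
    (Y : ℝ → Fin s → EuclideanSpace ℝ (Fin d))
    (hY : ∀ᶠ Δt : ℝ in 𝓝[>] 0, M.IsStageSolution f y Δt (Y Δt)) :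
    (∀ i, (fun Δt : ℝ => Y Δt i - (y + nbSum f p (fun τ => M.stageCoeff i τ y Δt) y Δt))
      =O[𝓝[>] 0] (fun Δt => Δt ^ (p + 1))) ∧
    (∀ i ν, (fun Δt : ℝ => Δt • f ν (Y Δt i) - nbSum f p (fun τ => M.g i ν τ y Δt) y Δt)
      =O[𝓝[>] 0] (fun Δt => Δt ^ (p + 1))) ∧
    ((∀ ν j, (fun Δt : ℝ => M.b ν j y Δt) =O[𝓝[>] 0] (fun _ => (1 : ℝ))) →
      (fun Δt : ℝ => M.output f y Δt (Y Δt) - (y + nbSum f p (fun τ => M.u τ y Δt) y Δt))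
        =O[𝓝[>] 0] (fun Δt => Δt ^ (p + 1))) := by
  have hg := NSARK.isBigO_smul_sub_nbSum
    (fun ν => (hf ν).of_le (by exact_mod_cast p.le_succ)) hLip ha hY p le_rfl
  refine ⟨NSARK.isBigO_stage_sub_nbSum ha hY hg, hg, fun hb => ?_⟩
  simpa only [NSARK.output, NSARK.u, add_sub_add_left_eq_sub] using
    NSARK.isBigO_sum_sub_nbSum (c := fun ν j Δt => M.b ν j y Δt) hb hg
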